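/- Let $\Bbbk$ be an algebraically closed field with $\operatorname{char}\Bbbk\neq 2$, and let $\mu=(\mu_{ij})\in M(n,\Bbbk)$ satisfy $\mu_{ij}\mu_{ji}=1$ and $\mu_{ii}=1$ for all $i,j$. Let $S$ be the $\Bbbk$-algebra on generators $z_1,\dots,z_n$ with defining relations $z_jz_i=\mu_{ij}z_iz_j$, with $S_1=\sum_i\Bbbk z_i\cong\Bbbk^n$ and $S_2=S_1S_1$, and let $U\subseteq S_1\otimes S_1$ be the span of these relations. A matrix $M\in M(n,\Bbbk)$ is $\mu$-symmetric if $M_{ij}=\mu_{ij}M_{ji}$ for all $i,j$; let $M^\mu(n,\Bbbk)$ be the space of such matrices, and put $\tau(M)=\sum_{i,j}M_{ij}z_iz_j\in S_2$. Let $Q\in S_2$. Its $\mu$-rank is $0$ if $Q=0$; it is $1$ if $Q=L^2$ for some nonzero $L\in S_1$; it is $2$ if $Q=L_1L_2$ for some nonzero $L_1,L_2\in S_1$ but $Q\ne L^2$ for every nonzero $L\in S_1$. The $\mu$-rank of $M\in\mathbb P(M^\mu(n,\Bbbk))$ is that of $\tau(M)$. Let $M_1,\dots,M_n\in M^\mu(n,\Bbbk)$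 be linearly independent and put $q_k=\tau(M_k)$. A sequence $g_1,\dots,g_m$ in a ring $B$ is normalizing if each $g_i$ is a normal element of $B/\langle g_1,\dots,g_{i-1}\rangle$. Assume that the quadric system $\sum_k\Bbbk q_k$ is normalizing, that is, spanned by a normalizing sequence in $S$, and base-point free, that is, no point $(p,r)\in\mathbb P(S_1^*)\times\mathbb P(S_1^*)$ is a common zero of $U$ and of the lifts of $q_1,\dots,q_n$ to $S_1\otimes S_1$. Let $A$ be a graded skew Clifford algebra associated to $\mu$ and $M_1,\dots,M_n$: a graded $\Bbbk$-algebra on generators $x_1,\dots,x_n$ of degree one and $y_1,\dots,y_n$ of degree two, whose defining relations are $$x_ix_j+\mu_{ij}x_jx_i=\sum_{k=1}^n(M_k)_{ij}\,y_k\qquad(1\le i,j\le n)$$ together with homogeneous relations of degree at least three, such that $\sum_k\Bbbk y_k$ is spanned by a normalizing sequence $y_1',\dots,y_n'$ of $A$. Let $V=S_1^*$, identify $x_1,\dots,x_n$ with the basis of $V$ dual to $z_1,\dots,z_n$, and let $W\subseteq V\otimes V$ be the space of quadratic relations of $A$, that is, the kernel of the multiplication map $V\otimes V\to A$ (so that $A=T(V)/\langle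 W\rangle$ when $A$ is quadratic). Let $$\Gamma=\{(a,b)\in\mathbb P(S_1)\times\mathbb P(S_1): w(a,b)=0\text{ for all }w\in W\}.$$ Identify $\mathbb P(S_1)$ with $\mathbb P^{n-1}$ through the basis $z_1,\dots,z_n$, and define $$\Phi:\mathbb P^{n-1}\times\mathbb P^{n-1}\to\mathbb P(M^\mu(n,\Bbbk)),\qquad \Phi(a,b)=\bigl(a_ib_j+\mu_{ij}a_jb_i\bigr)_{i,j}.$$ Then $$\Phi(\Gamma)=\Bigl\{M\in\mathbb P\Bigl(\sum_{k=1}^n\Bbbk M_k\Bigr):\ \mu\text{-rank}(M)\le2\Bigr\}.$$ -/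

import Mathlib

open scoped LinearAlgebra.Projectivization TensorProduct

namespace SkewClifford

/-- The parameters `μ`: `μ_ij μ_ji = 1` (so all entries are nonzero) and `μ_ii = 1`. -/
structure IsSkewParam {k : Type*} [Field k] {n : ℕ} (μ : Matrix (Fin n) (Fin n) k) : Prop where
  mul_eq_one : ∀ i j, μ i j * μ j i = 1
  diag : ∀ i, μ i i = 1

/-! ## Normalizing sequences -/

/-- `g` is a normal element of the quotient ring `B / I`, i.e. `g (B/I) = (B/I) g`. -/
def IsNormalMod {B : Type*} [Ring B] (I : TwoSidedIdeal B) (g : B) : Prop :=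
  (∀ r, ∃ s, g * r - s * g ∈ I) ∧ (∀ r, ∃ s, r * g - g * s ∈ I)

/-- `g_1, …, g_m` is a normalizing sequence in `B`: each `g_i` is normal in
`B / ⟨g_1, …, g_{i-1}⟩`. -/
def IsNormalizingSeq {B : Type*} [Ring B] {m : ℕ} (g : Fin m → B) : Prop :=
  ∀ i, IsNormalMod (TwoSidedIdeal.span (g '' {j | j < i})) (g i)

/-! ## The skew polynomial ring `S` -/

/-- The defining relations `z_j z_i = μ_ij z_i z_j` of `S`. -/
inductive SRel {k : Type*} [Field k] {n : ℕ} (μ : Matrix (Fin n) (Fin n) k) :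
    FreeAlgebra k (Fin n) → FreeAlgebra k (Fin n) → Prop
  | comm (i j : Fin n) :
      SRel μ (FreeAlgebra.ι k j * FreeAlgebra.ι k i)
        (μ i j • (FreeAlgebra.ι k i * FreeAlgebra.ι k j))

/-- The quadratic algebra `S` on generators `z_1, …, z_n`. -/
abbrev S {k : Type*} [Field k] {n : ℕ} (μ : Matrix (Fin n) (Fin n) k) : Type _ :=
  RingQuot (SRel μ)

/-- The generators `z_i` of `S`. -/
noncomputable def z {k : Type*} [Field k] {n : ℕ} (μ : Matrix (Fin n) (Fin n) k) (i : Fin n) :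
    S μ :=
  RingQuot.mkAlgHom k (SRel μ) (FreeAlgebra.ι k i)

/-- The linear form `∑ a_i z_i` with coordinate vector `a`; its range is `S_1`. The coordinate
space `Fin n → k` is used as the model of `S_1`, with `z_i` as the `i`-th standard vector. -/
noncomputable def linForm {k : Type*} [Field k] {n : ℕ} (μ : Matrix (Fin n) (Fin n) k) :
    (Fin n → k) →ₗ[k] S μ :=
  Fintype.linearCombination k (z μ)

/-- The multiplication map `T(S_1)_2 = S_1 ⊗ S_1 → S_2 ⊆ S`. -/
noncomputable def toS {k : Type*} [Field k] {n : ℕ} (μ : Matrix (Fin n) (Fin n) k) :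
    (Fin n → k) ⊗[k] (Fin n → k) →ₗ[k] S μ :=
  LinearMap.mul' k (S μ) ∘ₗ TensorProduct.map (linForm μ) (linForm μ)

/-- The span `U ⊆ T(S_1)_2` of the defining relations of `S`. -/
def U {k : Type*} [Field k] {n : ℕ} (μ : Matrix (Fin n) (Fin n) k) :
    Submodule k ((Fin n → k) ⊗[k] (Fin n → k)) :=
  Submodule.span k {u | ∃ i j : Fin n,
    u = (Pi.single j 1 : Fin n → k) ⊗ₜ[k] (Pi.single i 1 : Fin n → k)
      - μ i j • ((Pi.single i 1 : Fin n → k) ⊗ₜ[k] (Pi.single j 1 : Fin n → k))}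

/-! ## `μ`-symmetric matrices and quadratic forms -/

/-- The space `M^μ(n, k)` of `μ`-symmetric matrices. -/
def muSymm {k : Type*} [Field k] {n : ℕ} (μ : Matrix (Fin n) (Fin n) k) :
    Submodule k (Matrix (Fin n) (Fin n) k) where
  carrier := {M | ∀ i j, M i j = μ i j * M j i}
  add_mem' := by
    intro M N hM hN i j
    rw [Matrix.add_apply, Matrix.add_apply, hM i j, hN i j, mul_add]
  zero_mem' := by intro i j; simp
  smul_mem' := by
    intro c M hM i j
    rw [Matrix.smul_apply, Matrix.smul_apply, hM i j, smul_eq_mul, smul_eq_mul]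
    ring

/-- `τ(M) = zᵀ M z`. -/
noncomputable def tau {k : Type*} [Field k] {n : ℕ} {μ : Matrix (Fin n) (Fin n) k}
    (M : muSymm μ) : S μ :=
  ∑ i, ∑ j, M.1 i j • (z μ i * z μ j)

/-- `HasMuRank μ Q r`: the quadratic form `Q` has `μ`-rank `r` (a partial notion, with values
in `{0, 1, 2}`). -/
def HasMuRank {k : Type*} [Field k] {n : ℕ} (μ : Matrix (Fin n) (Fin n) k) (Q : S μ) :
    ℕ → Prop
  | 0 => Q = 0
  | 1 => ∃ L ∈ LinearMap.range (linForm μ), L ≠ 0 ∧ Q = L ^ 2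
  | 2 => (¬ ∃ L ∈ LinearMap.range (linForm μ), L ≠ 0 ∧ Q = L ^ 2) ∧
      ∃ L₁ ∈ LinearMap.range (linForm μ), ∃ L₂ ∈ LinearMap.range (linForm μ),
        L₁ ≠ 0 ∧ L₂ ≠ 0 ∧ Q = L₁ * L₂
  | _ => False

/-- The point `P` of `ℙ(M^μ(n, k))` has `μ`-rank at most two. (Over an algebraically closed field
the `μ`-rank does not change under nonzero scaling.) -/
def MuRankLETwo {k : Type*} [Field k] {n : ℕ} {μ : Matrix (Fin n) (Fin n) k}
    (P : ℙ k (muSymm μ)) : Prop :=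
  ∃ r ≤ 2, HasMuRank μ (tau P.rep) r

/-! ## Quadric systems -/

/-- The value of `u ∈ T(S_1)_2` at the pair `(p, r)` of linear functionals on `S_1`. -/
noncomputable def evalAt {k : Type*} [Field k] {n : ℕ} (p r : Module.Dual k (Fin n → k)) :
    Module.Dual k ((Fin n → k) ⊗[k] (Fin n → k)) :=
  TensorProduct.dualDistrib k (Fin n → k) (Fin n → k) (p ⊗ₜ[k] r)

/-- The zero locus of `U` in `ℙ(S_1^*) × ℙ(S_1^*)`. -/
def zeroLocusU {k : Type*} [Field k] {n : ℕ} (μ : Matrix (Fin n) (Fin n) k) :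
    Set (ℙ k (Module.Dual k (Fin n → k)) × ℙ k (Module.Dual k (Fin n → k))) :=
  {x | ∀ u ∈ U μ, evalAt x.1.rep x.2.rep u = 0}

/-- The quadric associated to `Q ∈ S_2`: the points of the zero locus of `U` at which the lifts
of `Q` to `T(S_1)_2` vanish. -/
def quadric {k : Type*} [Field k] {n : ℕ} (μ : Matrix (Fin n) (Fin n) k) (Q : S μ) :
    Set (ℙ k (Module.Dual k (Fin n → k)) × ℙ k (Module.Dual k (Fin n → k))) :=
  {x | x ∈ zeroLocusU μ ∧ ∀ Qhat, toS μ Qhat = Q → evalAt x.1.rep x.2.rep Qhat = 0}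

/-- The quadric system spanned by `Q_1, …, Q_m` is base-point free. -/
def BasePointFree {k : Type*} [Field k] {n m : ℕ} (μ : Matrix (Fin n) (Fin n) k)
    (Q : Fin m → S μ) : Prop :=
  {x | ∀ l, x ∈ quadric μ (Q l)} = ∅

/-- The quadric system spanned by `Q_1, …, Q_m` is normalizing: it is the span of a normalizing
sequence in `S`. -/
def NormalizingSystem {k : Type*} [Field k] {n m : ℕ} (μ : Matrix (Fin n) (Fin n) k)
    (Q : Fin m → S μ) : Prop :=
  ∃ (l : ℕ) (Q' : Fin l → S μ),
    Submodule.span k (Set.range Q') = Submodule.span k (Set.range Q) ∧ IsNormalizingSeq Q'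

/-! ## Graded skew Clifford algebras -/

/-- The free algebra on `X_1, …, X_n` and `Y_1, …, Y_n`. -/
abbrev FreeXY (k : Type*) [Field k] (n : ℕ) : Type _ := FreeAlgebra k (Fin n ⊕ Fin n)

/-- The homogeneous component of degree `d` of the free algebra, where the `X_i` have degree one
and the `Y_i` have degree two. -/
def component (k : Type*) [Field k] (n d : ℕ) : Submodule k (FreeXY k n) :=
  Submodule.span k {m | ∃ l : List (Fin n ⊕ Fin n),
    (l.map (Sum.elim (fun _ => 1) (fun _ => 2))).sum = d ∧ m = (l.map (FreeAlgebra.ι k)).prod}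

/-- The relations `x_i x_j + μ_ij x_j x_i = ∑_l (M_l)_ij y_l`, together with a set `R` of further
relations `r = 0`. -/
inductive ARel {k : Type*} [Field k] {n : ℕ} {μ : Matrix (Fin n) (Fin n) k}
    (M : Fin n → muSymm μ) (R : Set (FreeXY k n)) : FreeXY k n → FreeXY k n → Prop
  | clifford (i j : Fin n) :
      ARel M R
        (FreeAlgebra.ι k (Sum.inl i) * FreeAlgebra.ι k (Sum.inl j)
          + μ i j • (FreeAlgebra.ι k (Sum.inl j) * FreeAlgebra.ι k (Sum.inl i)))
        (∑ l, (M l).1 i j • FreeAlgebra.ι k (Sum.inr l))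
  | further (r : FreeXY k n) (hr : r ∈ R) : ARel M R r 0

/-- The algebra on `x_1, …, x_n, y_1, …, y_n` with the relations `ARel M R`. -/
abbrev A {k : Type*} [Field k] {n : ℕ} {μ : Matrix (Fin n) (Fin n) k}
    (M : Fin n → muSymm μ) (R : Set (FreeXY k n)) : Type _ :=
  RingQuot (ARel M R)

/-- The generators `x_i` of `A`. -/
noncomputable def x {k : Type*} [Field k] {n : ℕ} {μ : Matrix (Fin n) (Fin n) k}
    (M : Fin n → muSymm μ) (R : Set (FreeXY k n)) (i : Fin n) : A M R :=
  RingQuot.mkAlgHom k (ARel M R) (FreeAlgebra.ι k (Sum.inl i))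

/-- The generators `y_i` of `A`. -/
noncomputable def y {k : Type*} [Field k] {n : ℕ} {μ : Matrix (Fin n) (Fin n) k}
    (M : Fin n → muSymm μ) (R : Set (FreeXY k n)) (i : Fin n) : A M R :=
  RingQuot.mkAlgHom k (ARel M R) (FreeAlgebra.ι k (Sum.inr i))

/-- `A M R` is a graded skew Clifford algebra associated to `μ` and `M_1, …, M_n`: the relations
imposed beyond the Clifford relations in degree two are homogeneous of degree at least three
(the degrees in which normality of elements of `∑ k y_l` is expressed), and `∑ k y_l` is spanned
by a normalizing sequence of `A`. -/
structure IsGSCA {k : Type*} [Field k] {n : ℕ} {μ : Matrix (Fin n) (Fin n) k}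
    (M : Fin n → muSymm μ) (R : Set (FreeXY k n)) : Prop where
  homogeneous : ∀ r ∈ R, ∃ d, 3 ≤ d ∧ r ∈ component k n d
  normalizing : ∃ y' : Fin n → A M R,
    Submodule.span k (Set.range y') = Submodule.span k (Set.range (y M R)) ∧ IsNormalizingSeq y'

/-- The map `V = (S_1)^* → A` that sends the dual basis of `z_1, …, z_n` to `x_1, …, x_n`. -/
noncomputable def fromV {k : Type*} [Field k] {n : ℕ} {μ : Matrix (Fin n) (Fin n) k}
    (M : Fin n → muSymm μ) (R : Set (FreeXY k n)) :
    Module.Dual k (Fin n → k) →ₗ[k] A M R :=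
  (Pi.basisFun k (Fin n)).dualBasis.constr k (x M R)

/-- The space `W ⊆ T(V)_2 = V ⊗ V` of quadratic relations of `A` in the generators
`x_1, …, x_n`, i.e. the kernel of `T(V)_2 → A`. If `A = T(V)/⟨W'⟩` with `W' ⊆ T(V)_2`, then
`W'` is this space. -/
noncomputable def W {k : Type*} [Field k] {n : ℕ} {μ : Matrix (Fin n) (Fin n) k}
    (M : Fin n → muSymm μ) (R : Set (FreeXY k n)) :
    Submodule k (Module.Dual k (Fin n → k) ⊗[k] Module.Dual k (Fin n → k)) :=
  LinearMap.ker (LinearMap.mul' k (A M R) ∘ₗ TensorProduct.map (fromV M R) (fromV M R))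

/-- The zero locus `Γ` of `W` in `ℙ(S_1) × ℙ(S_1)`. -/
def Gam {k : Type*} [Field k] {n : ℕ} {μ : Matrix (Fin n) (Fin n) k}
    (M : Fin n → muSymm μ) (R : Set (FreeXY k n)) :
    Set (ℙ k (Fin n → k) × ℙ k (Fin n → k)) :=
  {p | ∀ w ∈ W M R,
    TensorProduct.dualDistrib k (Fin n → k) (Fin n → k) w (p.1.rep ⊗ₜ[k] p.2.rep) = 0}

/-! ## The map `Φ` -/

/-- The `μ`-symmetric matrix `(a_i b_j + μ_ij a_j b_i)`. -/
def phiMat {k : Type*} [Field k] {n : ℕ} {μ : Matrix (Fin n) (Fin n) k} (hμ : IsSkewParam μ)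
    (a b : Fin n → k) : muSymm μ :=
  ⟨Matrix.of fun i j => a i * b j + μ i j * (a j * b i), by
    intro i j
    simp only [Matrix.of_apply]
    linear_combination (-(a i * b j)) * hμ.mul_eq_one i j⟩

theorem phiMat_ne_zero {k : Type*} [Field k] {n : ℕ} {μ : Matrix (Fin n) (Fin n) k}
    (hμ : IsSkewParam μ) (h2 : (2 : k) ≠ 0) {a b : Fin n → k} (ha : a ≠ 0) (hb : b ≠ 0) :
    phiMat hμ a b ≠ 0 := by
  intro h
  have key : ∀ i j, a i * b j + μ i j * (a j * b i) = 0 := fun i j =>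
    congrFun (congrFun (congrArg Subtype.val h) i) j
  obtain ⟨i, hi⟩ := Function.ne_iff.mp ha
  obtain ⟨j, hj⟩ := Function.ne_iff.mp hb
  simp only [Pi.zero_apply] at hi hj
  have h1 : 2 * (a i * b i) = 0 := by
    have := key i i
    rw [hμ.diag i] at this
    linear_combination this
  have hbi : b i = 0 := by simpa [h2, hi] using h1
  have h3 := key i j
  rw [hbi] at h3
  simp [hi, hj] at h3

/-- `Φ : ℙ^{n-1} × ℙ^{n-1} → ℙ(M^μ(n, k))`. -/
noncomputable def Phi {k : Type*} [Field k] {n : ℕ} {μ : Matrix (Fin n) (Fin n) k}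
    (hμ : IsSkewParam μ) (h2 : (2 : k) ≠ 0) (p : ℙ k (Fin n → k) × ℙ k (Fin n → k)) :
    ℙ k (muSymm μ) :=
  Projectivization.mk k (phiMat hμ p.1.rep p.2.rep)
    (phiMat_ne_zero hμ h2 p.1.rep_nonzero p.2.rep_nonzero)

/-- `Φ` does not depend on the choice of representatives. -/
theorem Phi_mk {k : Type*} [Field k] {n : ℕ} {μ : Matrix (Fin n) (Fin n) k}
    (hμ : IsSkewParam μ) (h2 : (2 : k) ≠ 0) (a b : Fin n → k) (ha : a ≠ 0) (hb : b ≠ 0) :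
    Phi hμ h2 (Projectivization.mk k a ha, Projectivization.mk k b hb) =
      Projectivization.mk k (phiMat hμ a b) (phiMat_ne_zero hμ h2 ha hb) := by
  obtain ⟨c, hc⟩ := Projectivization.exists_smul_eq_mk_rep k a ha
  obtain ⟨d, hd⟩ := Projectivization.exists_smul_eq_mk_rep k b hb
  rw [Phi, Projectivization.mk_eq_mk_iff]
  refine ⟨c * d, ?_⟩
  simp only [← hc, ← hd]
  apply Subtype.ext
  ext i j
  simp only [phiMat, Units.smul_def, Units.val_mul, Submodule.coe_smul, Matrix.smul_apply,
    Matrix.of_apply, Pi.smul_apply, smul_eq_mul]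
  ring

end SkewClifford

namespace SkewClifford

variable {k : Type*} [Field k] {n : ℕ} {μ : Matrix (Fin n) (Fin n) k}

/-! In `S` one has `τ(Φ(a,b)) = 2 L_a L_b` (`tau_phiMat`), and `τ` is injective (`tau_injective`).
So a nonzero `μ`-symmetric matrix has `μ`-rank at most two exactly when it is proportional to some
`phiMat a b`: the rank locus is the whole image of `Φ` (`muRankLETwo_iff`). It remains to see that
`Γ` is the preimage under `Φ` of `ℙ(∑ k M_l)` (`mem_Gam_iff`). A functional killing all `M_l` gives
a combination of Clifford relations free of the `y_l`, hence an element of `W`, and its value at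
`(a,b)` is the functional at `phiMat a b`. Conversely, `phiMat a b = ∑ c_l M_l` yields a
representation of `A` on `k³` (`pointRep`) in which evaluation at `(a,b)` is a matrix coefficient,
so all of `W` vanishes there. -/

/-! ### Quadratic forms in `S` and their factorizations -/

theorem z_mul_z (i j : Fin n) : z μ j * z μ i = μ i j • (z μ i * z μ j) := by
  simpa [z] using RingQuot.mkAlgHom_rel k (SRel.comm (μ := μ) i j)

theorem linForm_apply (a : Fin n → k) : linForm μ a = ∑ i, a i • z μ i := by
  simp [linForm, Fintype.linearCombination_apply]

theorem tau_smul (c : k) (M : muSymm μ) : tau (c • M) = c • tau M := by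
  simp [tau, Finset.smul_sum, smul_smul]

/-- The relation `z_j z_i = μ_ij z_i z_j` and a swap of indices turn the `μ`-twisted half of the sum
into the other half. -/
theorem tau_phiMat (hμ : IsSkewParam μ) (a b : Fin n → k) :
    tau (phiMat hμ a b) = (2 : k) • (linForm μ a * linForm μ b) := by
  have h : linForm μ a * linForm μ b = ∑ i, ∑ j, (a i * b j) • (z μ i * z μ j) := by
    simp only [linForm_apply, Finset.sum_mul_sum, smul_mul_smul_comm]
  have h' : ∑ i, ∑ j, (μ i j * (a j * b i)) • (z μ i * z μ j)
      = linForm μ a * linForm μ b := by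
    rw [h, Finset.sum_comm]
    refine Finset.sum_congr rfl fun j _ => Finset.sum_congr rfl fun i _ => ?_
    rw [z_mul_z i j, smul_smul, mul_comm]
  simp only [tau, phiMat, Matrix.of_apply, add_smul, Finset.sum_add_distrib]
  rw [h', ← h, two_smul]

/-- The operator `(u, v, w) ↦ (v_i, (f_ji w)_j, 0)`. For `f_ji = μ_ij f_ij` these operators
satisfy the relations of `S`. -/
def formOp (f : Fin n → Fin n → k) (i : Fin n) : Module.End k (k × (Fin n → k) × k) where
  toFun t := (t.2.1 i, fun j => f j i * t.2.2, 0)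
  map_add' s t := by ext <;> simp [mul_add]
  map_smul' c t := by ext <;> simp [mul_left_comm]

theorem formOp_mul_apply (f : Fin n → Fin n → k) (i j : Fin n) (t : k × (Fin n → k) × k) :
    (formOp f i * formOp f j) t = (f i j * t.2.2, 0, 0) := by
  ext <;> simp [formOp]

/-- The representation of `S` by the operators `formOp f i`. -/
noncomputable def formRep (f : Fin n → Fin n → k) (hf : ∀ i j, f j i = μ i j * f i j) :
    S μ →ₐ[k] Module.End k (k × (Fin n → k) × k) :=
  RingQuot.liftAlgHom k ⟨FreeAlgebra.lift k (formOp f), by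
    rintro _ _ ⟨i, j⟩
    simp only [map_mul, map_smul, FreeAlgebra.lift_ι_apply]
    refine LinearMap.ext fun t => ?_
    rw [LinearMap.smul_apply, formOp_mul_apply, formOp_mul_apply, hf i j]
    ext <;> simp [mul_assoc]⟩

theorem formRep_z (f : Fin n → Fin n → k) (hf : ∀ i j, f j i = μ i j * f i j) (i : Fin n) :
    formRep f hf (z μ i) = formOp f i := by
  simp [formRep, z]

theorem formRep_tau (f : Fin n → Fin n → k) (hf : ∀ i j, f j i = μ i j * f i j)
    (M : muSymm μ) :
    (formRep f hf (tau M) (0, 0, 1)).1 = ∑ i, ∑ j, M.1 i j * f i j := by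
  simp only [tau, map_sum, map_smul, map_mul, formRep_z, LinearMap.sum_apply,
    LinearMap.smul_apply, formOp_mul_apply, Prod.fst_sum, Prod.smul_fst, smul_eq_mul, mul_one]

/-- The entries of `M` are recovered from `tau M` as matrix coefficients of the representations
`formRep`, up to the factor 2. This avoids a monomial basis of `S`. -/
theorem tau_injective (hμ : IsSkewParam μ) (h2 : (2 : k) ≠ 0) :
    Function.Injective (tau (μ := μ)) := by
  intro M N h
  apply Subtype.ext
  ext p q
  -- `g` is the indicator of `(p, q)`; its `μ`-symmetrization `g i j + μ j i * g j i` satisfies the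
  -- compatibility that `formRep` requires. Both halves pair with `M` to `M p q`.
  let g : Fin n → Fin n → k := fun i j => if i = p then if j = q then 1 else 0 else 0
  have hf : ∀ i j, (g j i + μ i j * g i j) = μ i j * (g i j + μ j i * g j i) := fun i j => by
    linear_combination (-(g j i)) * hμ.mul_eq_one i j
  have key (M : muSymm μ) :
      (formRep (fun i j => g i j + μ j i * g j i) hf (tau M) (0, 0, 1)).1 = 2 * M.1 p q := by
    have h1 : ∑ i, ∑ j, M.1 i j * g i j = M.1 p q := by simp [g]
    have h3 : ∑ i, ∑ j, M.1 i j * (μ j i * g j i) = M.1 p q := by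
      rw [Finset.sum_comm, M.2 p q]
      simp [g, mul_comm]
    simp only [formRep_tau, mul_add, Finset.sum_add_distrib, h1, h3, two_mul]
  exact mul_left_cancel₀ h2 (by rw [← key M, ← key N, h])

theorem tau_zero : tau (0 : muSymm μ) = 0 := by
  simp [tau]

/-- If `L_a = 0` then `τ(Φ(a,a)) = 2 L_a² = 0`, against injectivity of `τ`. -/
theorem linForm_ne_zero (hμ : IsSkewParam μ) (h2 : (2 : k) ≠ 0) {a : Fin n → k} (ha : a ≠ 0) :
    linForm μ a ≠ 0 := fun h =>
  phiMat_ne_zero hμ h2 ha ha <| tau_injective hμ h2 <| by simp [tau_phiMat, h, tau_zero]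

theorem exists_hasMuRank_of_eq_mul {Q : S μ} {a b : Fin n → k}
    (ha : linForm μ a ≠ 0) (hb : linForm μ b ≠ 0) (h : Q = linForm μ a * linForm μ b) :
    ∃ r ≤ 2, HasMuRank μ Q r := by
  by_cases hL : ∃ L ∈ LinearMap.range (linForm μ), L ≠ 0 ∧ Q = L ^ 2
  · exact ⟨1, one_le_two, hL⟩
  · exact ⟨2, le_rfl, hL, _, ⟨a, rfl⟩, _, ⟨b, rfl⟩, ha, hb, h⟩

theorem exists_eq_mul_of_hasMuRank {Q : S μ} (hQ : Q ≠ 0) {r : ℕ} (h : HasMuRank μ Q r) :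
    ∃ a b : Fin n → k, a ≠ 0 ∧ b ≠ 0 ∧ Q = linForm μ a * linForm μ b := by
  obtain ⟨a, b, h⟩ : ∃ a b : Fin n → k, Q = linForm μ a * linForm μ b := by
    match r, h with
    | 0, h => exact absurd h hQ
    | 1, ⟨_, ⟨a, rfl⟩, _, h⟩ => exact ⟨a, a, by rw [h, sq]⟩
    | 2, ⟨_, _, ⟨a, rfl⟩, _, ⟨b, rfl⟩, _, _, h⟩ => exact ⟨a, b, h⟩
  refine ⟨a, b, ?_, ?_, h⟩ <;> rintro rfl <;> simp [h] at hQ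

/-- Up to a scalar, the `μ`-symmetric matrices of `μ`-rank at most two are the matrices
`phiMat a b`. -/
theorem muRankLETwo_iff (hμ : IsSkewParam μ) (h2 : (2 : k) ≠ 0) (P : ℙ k (muSymm μ)) :
    MuRankLETwo P ↔ ∃ p, Phi hμ h2 p = P := by
  constructor
  · rintro ⟨r, -, h⟩
    obtain ⟨a, b, ha, hb, h⟩ := exists_eq_mul_of_hasMuRank
      (fun h0 => P.rep_nonzero (tau_injective hμ h2 (h0.trans tau_zero.symm))) h
    refine ⟨(Projectivization.mk k a ha, Projectivization.mk k b hb), ?_⟩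
    rw [Phi_mk, ← P.mk_rep, eq_comm, Projectivization.mk_eq_mk_iff']
    refine ⟨2⁻¹, tau_injective hμ h2 ?_⟩
    rw [tau_smul, tau_phiMat, h, smul_smul, inv_mul_cancel₀ h2, one_smul]
  · rintro ⟨p, rfl⟩
    obtain ⟨c, hc⟩ := Projectivization.exists_smul_eq_mk_rep k (phiMat hμ p.1.rep p.2.rep)
      (phiMat_ne_zero hμ h2 p.1.rep_nonzero p.2.rep_nonzero)
    -- The scalar of the chosen representative and the 2 from `tau_phiMat` are absorbed into the
    -- left factor, so no square root is needed.
    refine exists_hasMuRank_of_eq_mul (a := ((c : k) * 2) • p.1.rep) (b := p.2.rep)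
      (linForm_ne_zero hμ h2 (smul_ne_zero (mul_ne_zero c.ne_zero h2) p.1.rep_nonzero))
      (linForm_ne_zero hμ h2 p.2.rep_nonzero) ?_
    rw [Phi, ← hc, Units.smul_def, tau_smul, tau_phiMat, map_smul, smul_mul_assoc, smul_smul]

/-! ### Representations of `A` on `k³` -/

/-- The action of the generators of `A` on `k × k × k` given by `x_i (u, v, w) = (a_i v, b_i w, 0)`
and `y_l (u, v, w) = (c_l w, 0, 0)`. -/
def genOp (a b c : Fin n → k) (g : Fin n ⊕ Fin n) : Module.End k (k × k × k) where
  toFun t := g.elim (fun i => (a i * t.2.1, b i * t.2.2, 0)) (fun l => (c l * t.2.2, 0, 0))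
  map_add' s t := by cases g <;> simp [mul_add]
  map_smul' r t := by cases g <;> simp [mul_left_comm]

@[simp]
theorem genOp_inl (a b c : Fin n → k) (i : Fin n) (t : k × k × k) :
    genOp a b c (Sum.inl i) t = (a i * t.2.1, b i * t.2.2, 0) := rfl

@[simp]
theorem genOp_inr (a b c : Fin n → k) (l : Fin n) (t : k × k × k) :
    genOp a b c (Sum.inr l) t = (c l * t.2.2, 0, 0) := rfl

/-- A word of degree `d` in the operators `genOp` lowers the filtration of `k × k × k` by `d`. -/
theorem prod_genOp_apply (a b c : Fin n → k) (t : k × k × k) (l : List (Fin n ⊕ Fin n)) :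
    (1 ≤ (l.map (Sum.elim (fun _ => 1) (fun _ => 2))).sum →
      ((l.map (genOp a b c)).prod t).2.2 = 0) ∧
    (2 ≤ (l.map (Sum.elim (fun _ => 1) (fun _ => 2))).sum →
      ((l.map (genOp a b c)).prod t).2.1 = 0) ∧
    (3 ≤ (l.map (Sum.elim (fun _ => 1) (fun _ => 2))).sum →
      ((l.map (genOp a b c)).prod t).1 = 0) := by
  induction l with
  | nil => simp
  | cons g l ih =>
    obtain ⟨h1, h2, -⟩ := ih
    rcases g with i | i <;>
      simp only [List.map_cons, List.sum_cons, List.prod_cons, Module.End.mul_apply,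
        Sum.elim_inl, Sum.elim_inr, genOp_inl, genOp_inr]
    · exact ⟨fun _ => trivial, fun h => by rw [h1 (by omega), mul_zero],
        fun h => by rw [h2 (by omega), mul_zero]⟩
    · exact ⟨fun _ => trivial, fun _ => trivial, fun h => by rw [h1 (by omega), mul_zero]⟩

/-- The filtration of `k³` has only three steps, so the further relations of `A`, of degree at least
three, hold automatically. -/
theorem lift_genOp_eq_zero (a b c : Fin n → k) {d : ℕ} (hd : 3 ≤ d) {r : FreeXY k n}
    (hr : r ∈ component k n d) : FreeAlgebra.lift k (genOp a b c) r = 0 := by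
  induction hr using Submodule.span_induction with
  | mem r h =>
    obtain ⟨l, rfl, rfl⟩ := h
    refine LinearMap.ext fun t => ?_
    obtain ⟨h1, h2, h3⟩ := prod_genOp_apply a b c t l
    rw [map_list_prod, List.map_map]
    have : (FreeAlgebra.lift k (genOp a b c) ∘ FreeAlgebra.ι k) = genOp a b c :=
      FreeAlgebra.ι_comp_lift _
    rw [this]
    exact Prod.ext (h3 hd) (Prod.ext (h2 (by omega)) (h1 (by omega)))
  | zero => simp
  | add r s _ _ hr hs => rw [map_add, hr, hs, add_zero]
  | smul e r _ hr => rw [map_smul, hr, smul_zero]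

/-- The representation of `A` on `k × k × k` attached to a pair `(a, b)` with
`phiMat a b = ∑ c_l M_l`. -/
noncomputable def pointRep (hμ : IsSkewParam μ) {M : Fin n → muSymm μ} {R : Set (FreeXY k n)}
    (hR : ∀ r ∈ R, ∃ d, 3 ≤ d ∧ r ∈ component k n d) {a b c : Fin n → k}
    (h : ∑ l, c l • M l = phiMat hμ a b) : A M R →ₐ[k] Module.End k (k × k × k) :=
  RingQuot.liftAlgHom k ⟨FreeAlgebra.lift k (genOp a b c), by
    rintro _ _ (⟨i, j⟩ | ⟨_, hr⟩)
    · have hij : ∑ l, c l * (M l).1 i j = a i * b j + μ i j * (a j * b i) := by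
        have := congrFun (congrFun (congrArg Subtype.val h) i) j
        simpa [phiMat, Matrix.sum_apply] using this
      simp only [map_add, map_mul, map_smul, map_sum, FreeAlgebra.lift_ι_apply]
      refine LinearMap.ext fun t => ?_
      have hs : ∑ l, (M l).1 i j * (c l * t.2.2) = (∑ l, c l * (M l).1 i j) * t.2.2 := by
        rw [Finset.sum_mul]
        exact Finset.sum_congr rfl fun l _ => by ring
      refine Prod.ext ?_ (Prod.ext ?_ ?_)
      · simp only [LinearMap.add_apply, LinearMap.smul_apply, Module.End.mul_apply, genOp_inl,
          LinearMap.sum_apply, genOp_inr, Prod.fst_add, Prod.smul_fst, Prod.fst_sum, smul_eq_mul,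
          hs, hij]
        ring
      · simp [Prod.snd_sum]
      · simp [Prod.snd_sum]
    · obtain ⟨d, hd, hr⟩ := hR _ hr
      rw [lift_genOp_eq_zero a b c hd hr, map_zero]⟩

theorem pointRep_fromV (hμ : IsSkewParam μ) {M : Fin n → muSymm μ} {R : Set (FreeXY k n)}
    (hR : ∀ r ∈ R, ∃ d, 3 ≤ d ∧ r ∈ component k n d) {a b c : Fin n → k}
    (h : ∑ l, c l • M l = phiMat hμ a b) (f : Module.Dual k (Fin n → k)) (t : k × k × k) :
    pointRep hμ hR h (fromV M R f) t = (f a * t.2.1, f b * t.2.2, 0) := by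
  have hf : ∀ v : Fin n → k, f v = ∑ i, f (Pi.single i 1) * v i := fun v => by
    conv_lhs => rw [pi_eq_sum_univ' v]
    simp only [map_sum, map_smul, smul_eq_mul, mul_comm]
  have hx : ∀ i, pointRep hμ hR h (x M R i) = genOp a b c (Sum.inl i) := fun i => by
    simp [pointRep, x]
  have hV : fromV M R f = ∑ i, f (Pi.single i 1) • x M R i := by
    simp [fromV, Module.Basis.constr_apply_fintype]
  rw [hV, map_sum, LinearMap.sum_apply, hf a, hf b]
  refine Prod.ext ?_ (Prod.ext ?_ ?_) <;>
    simp [Prod.snd_sum, Prod.fst_sum, hx, Finset.sum_mul, mul_assoc]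

/-- In a product `f g` the factor `g` acts first, taking `(0,0,1)` to `(0, g b, 0)`; then `f`
contributes `f a`. Thus evaluation at `(a,b)` factors through `A`. -/
theorem pointRep_mul (hμ : IsSkewParam μ) {M : Fin n → muSymm μ} {R : Set (FreeXY k n)}
    (hR : ∀ r ∈ R, ∃ d, 3 ≤ d ∧ r ∈ component k n d) {a b c : Fin n → k}
    (h : ∑ l, c l • M l = phiMat hμ a b)
    (w : Module.Dual k (Fin n → k) ⊗[k] Module.Dual k (Fin n → k)) :
    (pointRep hμ hR h
      ((LinearMap.mul' k (A M R) ∘ₗ TensorProduct.map (fromV M R) (fromV M R)) w) (0, 0, 1)).1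
      = TensorProduct.dualDistrib k (Fin n → k) (Fin n → k) w (a ⊗ₜ[k] b) := by
  induction w using TensorProduct.induction_on with
  | zero => simp
  | tmul f g => simp [pointRep_fromV]
  | add v w hv hw => rw [map_add, map_add, LinearMap.add_apply, Prod.fst_add, hv, hw, map_add,
      LinearMap.add_apply]

/-! ### Quadratic relations of `A` and the zero locus `Γ` -/

theorem x_mul_x_add (M : Fin n → muSymm μ) (R : Set (FreeXY k n)) (i j : Fin n) :
    x M R i * x M R j + μ i j • (x M R j * x M R i) = ∑ l, (M l).1 i j • y M R l := by
  simpa [x, y] using RingQuot.mkAlgHom_rel k (ARel.clifford (M := M) (R := R) i j)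

/-- If a matrix `(d_ij)` is orthogonal to all `M_l`, then the combination with coefficients `d_ij`
of the left-hand sides of the Clifford relations is a quadratic relation of `A`. -/
theorem sum_mem_W {M : Fin n → muSymm μ} (R : Set (FreeXY k n)) {d : Fin n → Fin n → k}
    (hd : ∀ l, ∑ i, ∑ j, (M l).1 i j * d i j = 0) :
    ∑ i, ∑ j, d i j • ((Pi.basisFun k (Fin n)).dualBasis i ⊗ₜ[k] (Pi.basisFun k (Fin n)).dualBasis j
      + μ i j • ((Pi.basisFun k (Fin n)).dualBasis j ⊗ₜ[k] (Pi.basisFun k (Fin n)).dualBasis i))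
      ∈ W M R := by
  have hV : ∀ i, fromV M R ((Pi.basisFun k (Fin n)).dualBasis i) = x M R i := fun i =>
    Module.Basis.constr_basis _ _ _ _
  rw [W, LinearMap.mem_ker]
  simp only [map_sum, map_smul, map_add, LinearMap.comp_apply, TensorProduct.map_tmul,
    LinearMap.mul'_apply, hV, x_mul_x_add]
  calc ∑ i, ∑ j, d i j • ∑ l, (M l).1 i j • y M R l
      = ∑ i, ∑ j, ∑ l, ((M l).1 i j * d i j) • y M R l := by
        simp only [Finset.smul_sum, smul_smul, mul_comm]
    _ = ∑ l, (∑ i, ∑ j, (M l).1 i j * d i j) • y M R l := by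
        simp only [Finset.sum_smul]
        rw [Finset.sum_comm]
        refine (Finset.sum_congr rfl fun _ _ => Finset.sum_comm).trans ?_
        rw [Finset.sum_comm]
        exact Finset.sum_congr rfl fun _ _ => Finset.sum_comm
    _ = 0 := by simp [hd]

theorem mem_Gam_iff (hμ : IsSkewParam μ) {M : Fin n → muSymm μ} {R : Set (FreeXY k n)}
    (hR : ∀ r ∈ R, ∃ d, 3 ≤ d ∧ r ∈ component k n d) (p : ℙ k (Fin n → k) × ℙ k (Fin n → k)) :
    p ∈ Gam M R ↔ phiMat hμ p.1.rep p.2.rep ∈ Submodule.span k (Set.range M) := by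
  constructor
  · intro hp
    by_contra hN
    have hN' : (phiMat hμ p.1.rep p.2.rep).1 ∉
        (Submodule.span k (Set.range M)).map (muSymm μ).subtype := by
      rintro ⟨N, hN1, hN2⟩
      exact hN (Subtype.ext hN2 ▸ hN1)
    -- The separating functional lives on all matrices, so its values on the matrix units serve as
    -- the coefficients `d i j` of `sum_mem_W`.
    obtain ⟨f, hf, hf'⟩ := Submodule.exists_le_ker_of_notMem hN'
    have hfsum : ∀ N : Matrix (Fin n) (Fin n) k,
        f N = ∑ i, ∑ j, N i j * f (Matrix.single i j 1) := fun N => by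
      conv_lhs => rw [Matrix.matrix_eq_sum_single N]
      simp only [map_sum]
      refine Finset.sum_congr rfl fun i _ => Finset.sum_congr rfl fun j _ => ?_
      rw [← smul_eq_mul, ← map_smul, Matrix.smul_single, smul_eq_mul, mul_one]
    have hW := hp _ <| sum_mem_W R (d := fun i j => f (Matrix.single i j 1)) fun l => by
      rw [← hfsum]
      exact hf' ⟨M l, Submodule.subset_span ⟨l, rfl⟩, rfl⟩
    apply hf
    rw [hfsum, ← hW]
    simp [phiMat, mul_add, mul_comm]
  · intro h w hw
    obtain ⟨c, hc⟩ := (Submodule.mem_span_range_iff_exists_fun k).mp h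
    rw [← pointRep_mul hμ hR hc, LinearMap.mem_ker.mp hw]
    simp

end SkewClifford

open SkewClifford in
theorem proposition2p4 {k : Type*} [Field k] [IsAlgClosed k] (h2 : (2 : k) ≠ 0)
    {n : ℕ} (μ : Matrix (Fin n) (Fin n) k) (hμ : IsSkewParam μ)
    (M : Fin n → muSymm μ) (hM : LinearIndependent k M)
    (R : Set (FreeXY k n)) (hA : IsGSCA M R)
    (hnorm : NormalizingSystem μ (fun l => tau (M l)))
    (hbpf : BasePointFree μ (fun l => tau (M l))) :
    Phi hμ h2 '' Gam M R =
      {P : ℙ k (muSymm μ) | P.submodule ≤ Submodule.span k (Set.range M) ∧ MuRankLETwo P} := by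
  have hmem : ∀ p, p ∈ Gam M R ↔
      (Phi hμ h2 p).submodule ≤ Submodule.span k (Set.range M) := fun p => by
    rw [mem_Gam_iff hμ hA.homogeneous, Phi, Projectivization.submodule_mk,
      Submodule.span_singleton_le_iff_mem]
  ext P
  simp only [Set.mem_image, Set.mem_ofPred_eq, muRankLETwo_iff hμ h2, hmem]
  constructor
  · rintro ⟨p, hp, rfl⟩
    exact ⟨hp, p, rfl⟩
  · rintro ⟨hP, p, rfl⟩
    exact ⟨p, hP, rfl⟩
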